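/- Let $m\ge 1$ and $k\ge 0$ be integers, $q=2^m$, $d=\gcd(k,m)$ and $\sigma=2^k$. For $a,b,c\in\mathbb F_q$ let $G_{a,b,c}\colon\mathbb F_q^3\to\mathbb F_q^3$ be the function $G_{a,b,c}=(G_1,G_2,G_3)$ with $$\begin{aligned} G_1(x,y,z)&=x^{\sigma+1}+ay^{\sigma}z+bx^{\sigma}y+cx^{\sigma}z,\\ G_2(x,y,z)&=ay^{\sigma+1}+z^{\sigma}x+bz^{\sigma}y+cx^{\sigma}y,\\ G_3(x,y,z)&=z^{\sigma+1}+x^{\sigma}y, \end{aligned}$$ and let $F\colon\mathbb F_q^3\to\mathbb F_q^3$ be the function of the second family of Li and Kaleyski, $$F(x,y,z)=\bigl(x^{\sigma+1}+xy^{\sigma}+yz^{\sigma},\; xy^{\sigma}+z^{\sigma+1},\; x^{\sigma}z+y^{\sigma}z+y^{\sigma+1}\bigr).$$ The differential uniformity of a function $H\colon\mathbb F_q^3\to\mathbb F_q^3$ is $\max_{u\neq 0,\,v}\#\{w\in\mathbb F_q^3: H(w+u)-H(w)=v\}$. The hypotheses of Li and Kaleyski are that the polynomials $X^{\sigma^2+\sigma+1}+X+1$,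 $X^{\sigma^2+\sigma+1}+X^{\sigma^2}+1$ and $X^{\sigma^2+\sigma+1}+X^{\sigma+1}+X^{\sigma}+X+1$ have no roots in $\mathbb F_q$, and that $$X^{\sigma^2+\sigma+1}+X^{\sigma+1}Y^{\sigma^2}+XY^{\sigma}+X^{\sigma}Y^{\sigma^2}+X^{\sigma^2}Y+X^{\sigma^2}+Y^{\sigma^2+\sigma+1}+Y^{\sigma^2+1}+Y^{\sigma^2+\sigma}+Y^{\sigma^2}+1$$ has no zero in $\mathbb F_q^2$. Under these hypotheses they show that $F$ has differential uniformity $2^d$. Then: 1. $F$ is linearly equivalent to $G_{1,0,1}$, that is, $L_1\circ F\circ L_2=G_{1,0,1}$ for some bijective $\mathbb F_2$-linear maps $L_1,L_2\colon\mathbb F_q^3\to\mathbb F_q^3$. 2. The hypotheses of Li and Kaleyski can be replaced by the single condition that $X^{\sigma^2+\sigma+1}+X^{\sigma^2+\sigma}+1$ has no root in $\mathbb F_q$. That is, their hypotheses imply this condition, and this condition implies that the differential uniformity of $F$ is $2^d$. -/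

import Mathlib

/-- The entry `#{x : F (x + u) - F x = v}` of the difference distribution table of `F`. -/
noncomputable def ddt {V W : Type*} [AddGroup V] [AddGroup W] (F : V → W) (u : V) (v : W) : ℕ :=
  Nat.card {x : V // F (x + u) - F x = v}

/-- `F` has differential uniformity `δ`: the maximum of the entries `ddt F u v` over all `u ≠ 0`
and all `v` exists and equals `δ`. -/
def HasDifferentialUniformity {V W : Type*} [AddGroup V] [AddGroup W] (F : V → W) (δ : ℕ) : Prop :=
  IsGreatest {n : ℕ | ∃ (u : V) (v : W), u ≠ 0 ∧ ddt F u v = n} δ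

/-- `F` and `G` are linearly equivalent over `k`: `L₁ ∘ F ∘ L₂ = G` for invertible `k`-linear maps
`L₁` and `L₂`. -/
def LinearlyEquivalent (k : Type*) {V : Type*} [Semiring k] [AddCommMonoid V] [Module k V]
    (F G : V → V) : Prop :=
  ∃ L₁ L₂ : V ≃ₗ[k] V, (L₁ : V → V) ∘ F ∘ (L₂ : V → V) = G

/-- The family of trivariate functions with parameters `a`, `b`, `c` and `σ = 2 ^ k`. -/
def mainMap {K : Type*} [Field K] (k : ℕ) (a b c : K) (v : Fin 3 → K) : Fin 3 → K :=
  let σ := 2 ^ k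
  let x := v 0
  let y := v 1
  let z := v 2
  ![x ^ (σ + 1) + a * y ^ σ * z + b * x ^ σ * y + c * x ^ σ * z,
    a * y ^ (σ + 1) + z ^ σ * x + b * z ^ σ * y + c * x ^ σ * y,
    z ^ (σ + 1) + x ^ σ * y]

/-- The second trivariate function of Li and Kaleyski, with `σ = 2 ^ k`. -/
def liKaleyskiMap {K : Type*} [Field K] (k : ℕ) (v : Fin 3 → K) : Fin 3 → K :=
  let σ := 2 ^ k
  let x := v 0
  let y := v 1
  let z := v 2
  ![x ^ (σ + 1) + x * y ^ σ + y * z ^ σ,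
    x * y ^ σ + z ^ (σ + 1),
    x ^ σ * z + y ^ σ * z + y ^ (σ + 1)]

/-- The original hypotheses of Li and Kaleyski on their second family, with `σ = 2 ^ k`: three
univariate polynomials have no root in `K` and a bivariate polynomial has no zero in `K × K`. -/
def LiKaleyskiConditions (K : Type*) [Field K] (k : ℕ) : Prop :=
  let σ := 2 ^ k
  (∀ X : K, X ^ (σ ^ 2 + σ + 1) + X + 1 ≠ 0) ∧
  (∀ X : K, X ^ (σ ^ 2 + σ + 1) + X ^ (σ ^ 2) + 1 ≠ 0) ∧
  (∀ X : K, X ^ (σ ^ 2 + σ + 1) + X ^ (σ + 1) + X ^ σ + X + 1 ≠ 0) ∧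
  (∀ X Y : K, X ^ (σ ^ 2 + σ + 1) + X ^ (σ + 1) * Y ^ (σ ^ 2) + X * Y ^ σ + X ^ σ * Y ^ (σ ^ 2)
    + X ^ (σ ^ 2) * Y + X ^ (σ ^ 2) + Y ^ (σ ^ 2 + σ + 1) + Y ^ (σ ^ 2 + 1) + Y ^ (σ ^ 2 + σ)
    + Y ^ (σ ^ 2) + 1 ≠ 0)

/-- The single condition, with `σ = 2 ^ k`: the polynomial `X^(σ²+σ+1) + X^(σ²+σ) + 1` has no root
in `K`. -/
def SingleCondition (K : Type*) [Field K] (k : ℕ) : Prop :=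
  let σ := 2 ^ k
  ∀ X : K, X ^ (σ ^ 2 + σ + 1) + X ^ (σ ^ 2 + σ) + 1 ≠ 0

open scoped Matrix

/-! ### Vectors in `K³` and the cross product -/

section CrossProduct

variable {K : Type*} [Field K]

/-! Write `T v = L φ(v)` with `φ` the `2 ^ k`-power Frobenius and `L` a matrix over the prime field.
Up to the order of coordinates, `F v = v ⨯₃ T v`. Hence each derivative in direction `u ≠ 0` is
additive up to a constant, and its nonempty fibres are cosets of the kernel of `v ↦ u ⨯₃ T v + v ⨯₃
T u`. Let `v` lie in this kernel. If `v = t • u`, then `(φ t + t) • (u ⨯₃ T u) = 0`, so `t` is fixed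
by `φ` unless `T` preserves the line of `u`. Otherwise the plane of `u` and `v` is `T`-invariant,
and its normal `n` satisfies `Lᵀ n = s φ(n)`. The single condition excludes invariant lines
(`eq_zero_of_twist_eq_smul`) and invariant planes (`eq_zero_of_twistTranspose_eq_smul`). The kernel
is then `u` times the fixed field of `φ`, of size `2 ^ gcd(k, m)`. -/

theorem exists_smul_eq_of_crossProduct_eq_zero {u v : Fin 3 → K} (hu : u ≠ 0)
    (h : u ⨯₃ v = 0) : ∃ t : K, v = t • u := by
  by_contra hv
  refine crossProduct_ne_zero_iff_linearIndependent.2 ?_ h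
  rw [LinearIndependent.pair_iff' hu]
  exact fun t ht => hv ⟨t, ht.symm⟩

theorem exists_smul_crossProduct_eq {a u v : Fin 3 → K} (hn : u ⨯₃ v ≠ 0)
    (hu : a ⬝ᵥ u = 0) (hv : a ⬝ᵥ v = 0) : ∃ s : K, a = s • (u ⨯₃ v) := by
  refine exists_smul_eq_of_crossProduct_eq_zero hn ?_
  rw [cross_cross_eq_smul_sub_smul, dotProduct_comm u a, dotProduct_comm v a, hu, hv]
  simp

/-- The semilinear map `v ↦ L (φ v)` for the matrix `L` with rows `(0, 0, 1)`, `(1, 1, 0)`,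
`(0, 1, 0)`. -/
def twist (φ : K →+* K) (v : Fin 3 → K) : Fin 3 → K :=
  ![φ (v 2), φ (v 0) + φ (v 1), φ (v 1)]

/-- The transpose of the matrix used in `twist`. -/
def twistTranspose (n : Fin 3 → K) : Fin 3 → K :=
  ![n 1, n 1 + n 2, n 0]

theorem dotProduct_twist (φ : K →+* K) (n v : Fin 3 → K) :
    n ⬝ᵥ twist φ v = twistTranspose n ⬝ᵥ (fun i => φ (v i)) := by
  simp only [twist, twistTranspose, Matrix.vec3_dotProduct, Matrix.cons_val]
  ring

theorem twist_add (φ : K →+* K) (u v : Fin 3 → K) :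
    twist φ (u + v) = twist φ u + twist φ v := by
  ext i
  fin_cases i <;> (simp [twist]; try ring)

theorem twist_smul (φ : K →+* K) (t : K) (v : Fin 3 → K) :
    twist φ (t • v) = φ t • twist φ v := by
  ext i
  fin_cases i <;> (simp [twist]; try ring)

theorem map_crossProduct (φ : K →+* K) (u v : Fin 3 → K) :
    (fun i => φ (u i)) ⨯₃ (fun i => φ (v i)) = fun i => φ ((u ⨯₃ v) i) := by
  ext i
  fin_cases i <;> simp [cross_apply]

/-- The plane spanned by `u` and `v` is invariant under the twist as soon as
`u ⨯₃ twist φ v + v ⨯₃ twist φ u = 0`; this is the corresponding statement for its normal. -/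
theorem exists_twistTranspose_eq {φ : K →+* K} {u v : Fin 3 → K} (hn : u ⨯₃ v ≠ 0)
    (h : u ⨯₃ twist φ v + v ⨯₃ twist φ u = 0) :
    ∃ s : K, twistTranspose (u ⨯₃ v) = s • fun i => φ ((u ⨯₃ v) i) := by
  have hne : (fun i => φ (u i)) ⨯₃ (fun i => φ (v i)) ≠ 0 := by
    rw [map_crossProduct]
    intro h0
    exact hn (funext fun i => (map_eq_zero φ).1 (congrFun h0 i))
  have key : ∀ w : Fin 3 → K, w ⬝ᵥ (u ⨯₃ twist φ v) + w ⬝ᵥ (v ⨯₃ twist φ u) = 0 := by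
    intro w
    rw [← dotProduct_add, h, dotProduct_zero]
  have hu : twistTranspose (u ⨯₃ v) ⬝ᵥ (fun i => φ (u i)) = 0 := by
    have := key u
    rw [dot_self_cross, zero_add] at this
    rwa [← dotProduct_twist, dotProduct_comm, ← triple_product_permutation,
      ← triple_product_permutation]
  have hv : twistTranspose (u ⨯₃ v) ⬝ᵥ (fun i => φ (v i)) = 0 := by
    have := key v
    rw [dot_self_cross, add_zero] at this
    rw [← dotProduct_twist, dotProduct_comm, triple_product_permutation,
      triple_product_permutation, ← cross_anticomm, dotProduct_neg, this, neg_zero]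
  obtain ⟨s, hs⟩ := exists_smul_crossProduct_eq hne hu hv
  exact ⟨s, by rw [hs, map_crossProduct]⟩

variable [CharP K 2]

theorem eq_zero_of_twist_eq_smul {φ : K →+* K}
    (hφ : ∀ X : K, φ (φ X) * φ X * X + φ (φ X) * φ X + 1 ≠ 0) {v : Fin 3 → K} {s : K}
    (h : twist φ v = s • v) : v = 0 := by
  have h0 : φ (v 2) = s * v 0 := congrFun h 0
  have h1 : φ (v 0) + φ (v 1) = s * v 1 := congrFun h 1
  have h2 : φ (v 1) = s * v 2 := congrFun h 2
  have hy : v 1 = 0 := by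
    by_contra hy
    have hy1 : φ (v 1) ≠ 0 := (map_ne_zero φ).2 hy
    have hy2 : φ (φ (v 1)) ≠ 0 := (map_ne_zero φ).2 hy1
    have hy3 : φ (φ (φ (v 1))) ≠ 0 := (map_ne_zero φ).2 hy2
    have e1 : φ (φ (φ (v 1))) = φ (φ s) * φ s * φ (v 0) := by
      rw [h2, map_mul, map_mul, h0, map_mul]
      ring
    -- By `h1`, this `X` has `X + 1 = φ (v 0) / φ (v 1)`, while `e1` makes `φ (φ X) * φ X` its
    -- inverse.
    apply hφ (s * v 1 / φ (v 1))
    simp only [map_div₀, map_mul]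
    field_simp
    linear_combination φ s * φ (φ s) * (CharTwo.two_eq_zero (R := K)) * s * v 1 + e1
      + φ s * φ (φ s) * h1
  have hz : v 2 = 0 := by
    rcases mul_eq_zero.1 (h2.symm.trans (by rw [hy, map_zero])) with hs | hz
    · exact (map_eq_zero φ).1 (by rw [h0, hs, zero_mul])
    · exact hz
  have hx : v 0 = 0 := (map_eq_zero φ).1 (by simpa [hy] using h1)
  ext i
  fin_cases i <;> simp [hx, hy, hz]

/-- An invariant plane with normal `n` yields an invariant line, spanned by `n ⨯₃ Lᵀ n`, unless `n`
is an eigenvector of `Lᵀ`. In that case a ratio of its coordinates is a root fixed by `φ`. -/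
theorem eq_zero_of_twistTranspose_eq_smul {φ : K →+* K}
    (hφ : ∀ X : K, φ (φ X) * φ X * X + φ (φ X) * φ X + 1 ≠ 0) {n : Fin 3 → K} {s : K}
    (h : twistTranspose n = s • fun i => φ (n i)) : n = 0 := by
  have c2 : (2 : K) = 0 := CharTwo.two_eq_zero
  have h0 : n 1 = s * φ (n 0) := congrFun h 0
  have h1 : n 1 + n 2 = s * φ (n 1) := congrFun h 1
  have h2 : n 0 = s * φ (n 2) := congrFun h 2
  have hn0 : n 0 = 0 := by
    by_contra hn0
    obtain ⟨hs, hn2⟩ := mul_ne_zero_iff.1 (h2 ▸ hn0)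
    have hn2' : n 2 ≠ 0 := (map_ne_zero φ).1 hn2
    -- As `φ(n) = s⁻¹ Lᵀ n` and `Lᵀ a ⨯₃ Lᵀ b = det L • L⁻¹ (a ⨯₃ b)` with `det L = 1`, this vector
    -- is scaled by `s⁻²` under the twist.
    have hw : n ⨯₃ twistTranspose n = 0 := by
      refine eq_zero_of_twist_eq_smul (s := (s ^ 2)⁻¹) hφ ?_
      rw [eq_inv_smul_iff₀ (pow_ne_zero 2 hs)]
      ext i
      fin_cases i <;> simp [twist, twistTranspose, cross_apply]
      · linear_combination -(n 1 + n 2 + n 0) * h0 - s * φ (n 0) * (h1 + h2)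
          + (n 1 + n 2 + s * φ (n 1)) * h1
      · linear_combination -(n 1 + n 2) * h0 - s * φ (n 0) * h1 + (n 0 + s * φ (n 2)) * h2
          + (n 1 + s * φ (n 0)) * h0
      · linear_combination -n 0 * h1 - s * φ (n 1) * h2 + (n 1 + s * φ (n 0)) * h0
    have w1 : n 2 * n 1 - n 0 * n 0 = 0 := congrFun hw 1
    have w0 : n 1 * n 0 - n 2 * (n 1 + n 2) = 0 := congrFun hw 0
    have ht : φ (n 0) / φ (n 2) = n 0 / n 2 := by
      rw [div_eq_div_iff hn2 hn2']
      apply mul_left_cancel₀ hs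
      linear_combination -n 2 * h0 + n 0 * h2 + w1
    -- Since `φ` fixes `r = n 0 / n 2`, the polynomial becomes `r³ + r² + 1`, which vanishes because
    -- `n 1 / n 2 = r²` by `w1`.
    apply hφ (n 0 / n 2)
    rw [map_div₀, ht, map_div₀, ht]
    field_simp
    linear_combination n 2 * w0 - (n 0 + n 2) * w1 + (n 2 ^ 2 * n 1 + n 2 ^ 3) * c2
  have hn1 : n 1 = 0 := by rw [h0, hn0, map_zero, mul_zero]
  have hn2 : n 2 = 0 := by simpa [hn1] using h1
  ext i
  fin_cases i <;> simp [hn0, hn1, hn2]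

/-- If the twist fixes no line, then the symmetric bilinear map attached to `v ↦ v ⨯₃ twist φ v`
has radicals as small as possible. -/
theorem exists_fixed_smul_of_crossProduct_twist_add_eq_zero {φ : K →+* K}
    (hφ : ∀ X : K, φ (φ X) * φ X * X + φ (φ X) * φ X + 1 ≠ 0) {u v : Fin 3 → K} (hu : u ≠ 0)
    (h : u ⨯₃ twist φ v + v ⨯₃ twist φ u = 0) : ∃ t : K, φ t = t ∧ v = t • u := by
  by_cases hn : u ⨯₃ v = 0
  · obtain ⟨t, rfl⟩ := exists_smul_eq_of_crossProduct_eq_zero hu hn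
    refine ⟨t, ?_, rfl⟩
    rw [twist_smul, map_smul, map_smul, LinearMap.smul_apply, ← add_smul, smul_eq_zero] at h
    rcases h with h | h
    · exact CharTwo.add_eq_zero.1 h
    · obtain ⟨s, hs⟩ := exists_smul_eq_of_crossProduct_eq_zero hu h
      exact absurd (eq_zero_of_twist_eq_smul hφ hs) hu
  · obtain ⟨s, hs⟩ := exists_twistTranspose_eq hn h
    exact absurd (eq_zero_of_twistTranspose_eq_smul hφ hs) hn

end CrossProduct

/-! ### Counting fixed points of a power of the Frobenius -/

/-- The nonzero fixed points are the `(2 ^ k - 1)`-torsion of a cyclic group of order `2 ^ m - 1`;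
zero supplies the extra point, the `none` of the `Option`. -/
theorem card_fixed_pow {K : Type*} [Field K] [Finite K] {m : ℕ} (hK : Nat.card K = 2 ^ m)
    (k : ℕ) : Nat.card {t : K // t ^ 2 ^ k = t} = 2 ^ Nat.gcd k m := by
  have hker : Nat.card (powMonoidHom (2 ^ k - 1) : Kˣ →* Kˣ).ker = 2 ^ Nat.gcd k m - 1 := by
    rw [IsCyclic.card_powMonoidHom_ker, Nat.card_units, hK, Nat.pow_sub_one_gcd_pow_sub_one,
      Nat.gcd_comm]
  have e : {t : K // t ^ 2 ^ k = t} ≃ Option (powMonoidHom (2 ^ k - 1) : Kˣ →* Kˣ).ker := by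
    have hfix (g : (powMonoidHom (2 ^ k - 1) : Kˣ →* Kˣ).ker) : (g.1 : K) ^ 2 ^ k = g.1 := by
      have hg : (g.1 : K) ^ (2 ^ k - 1) = 1 := congrArg Units.val (MonoidHom.mem_ker.1 g.2)
      rw [← pow_sub_one_mul (NeZero.ne (2 ^ k)), hg, one_mul]
    refine (Equiv.ofBijective
      (fun g => g.elim ⟨0, zero_pow (by positivity)⟩ fun g => ⟨g.1, hfix g⟩) ⟨?_, ?_⟩).symm
    · rintro (_ | g) (_ | h) hgh
      · rfl
      · exact absurd (congrArg Subtype.val hgh).symm h.1.ne_zero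
      · exact absurd (congrArg Subtype.val hgh) g.1.ne_zero
      · exact congrArg some (Subtype.ext (Units.ext (congrArg Subtype.val hgh)))
    · rintro ⟨t, ht⟩
      by_cases ht0 : t = 0
      · exact ⟨none, Subtype.ext ht0.symm⟩
      · refine ⟨some ⟨Units.mk0 t ht0, MonoidHom.mem_ker.2 (Units.ext ?_)⟩, rfl⟩
        apply mul_right_cancel₀ ht0
        rw [← Nat.sub_add_cancel (Nat.one_le_two_pow (n := k)), pow_succ] at ht
        simpa using ht
  rw [Nat.card_congr e, Finite.card_option, hker, Nat.sub_add_cancel Nat.one_le_two_pow]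

/-! ### The function of Li and Kaleyski -/

section LiKaleyski

variable {K : Type*} [Field K] [CharP K 2]

theorem liKaleyskiMap_eq (k : ℕ) (v : Fin 3 → K) :
    liKaleyskiMap k v = (v ⨯₃ twist (iterateFrobenius K 2 k) v) ∘ Fin.rev := by
  ext i
  fin_cases i <;>
    simp [liKaleyskiMap, twist, cross_apply, iterateFrobenius_def, CharTwo.sub_eq_add, Fin.rev] <;>
    ring

theorem liKaleyskiMap_add_sub (k : ℕ) (u v : Fin 3 → K) :
    liKaleyskiMap k (v + u) - liKaleyskiMap k v = liKaleyskiMap k u +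
      (u ⨯₃ twist (iterateFrobenius K 2 k) v + v ⨯₃ twist (iterateFrobenius K 2 k) u) ∘
        Fin.rev := by
  ext i
  simp only [liKaleyskiMap_eq, twist_add, map_add, LinearMap.add_apply, Pi.sub_apply,
    Pi.add_apply, Function.comp_apply]
  ring

theorem liKaleyskiMap_derivative_eq_iff {k : ℕ} (hk : SingleCondition K k) {u v w : Fin 3 → K}
    (hu : u ≠ 0) :
    liKaleyskiMap k (v + u) - liKaleyskiMap k v = liKaleyskiMap k (w + u) - liKaleyskiMap k w ↔
      ∃ t : K, t ^ 2 ^ k = t ∧ v - w = t • u := by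
  have hφ : ∀ X : K, iterateFrobenius K 2 k (iterateFrobenius K 2 k X) * iterateFrobenius K 2 k X
      * X + iterateFrobenius K 2 k (iterateFrobenius K 2 k X) * iterateFrobenius K 2 k X + 1
      ≠ 0 := by
    intro X hX
    apply hk X
    rw [← hX]
    simp only [iterateFrobenius_def]
    ring
  have hlin : liKaleyskiMap k (v + u) - liKaleyskiMap k v =
      liKaleyskiMap k (w + u) - liKaleyskiMap k w ↔
      u ⨯₃ twist (iterateFrobenius K 2 k) (v - w) +
        (v - w) ⨯₃ twist (iterateFrobenius K 2 k) u = 0 := by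
    have hv : v = (v - w) + w := (sub_add_cancel v w).symm
    rw [liKaleyskiMap_add_sub, liKaleyskiMap_add_sub, add_right_inj,
      Fin.rev_surjective.injective_comp_right.eq_iff]
    nth_rw 1 2 [hv]
    rw [twist_add, map_add, map_add, LinearMap.add_apply, add_add_add_comm, add_eq_right]
  rw [hlin]
  constructor
  · intro h
    simpa only [iterateFrobenius_def] using
      exists_fixed_smul_of_crossProduct_twist_add_eq_zero hφ hu h
  · rintro ⟨t, ht, hvw⟩
    rw [hvw, twist_smul, iterateFrobenius_def, ht, map_smul, map_smul, LinearMap.smul_apply,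
      ← smul_add]
    ext i
    simp [CharTwo.add_self_eq_zero]

theorem ddt_liKaleyskiMap [Finite K] {m k : ℕ} (hK : Nat.card K = 2 ^ m)
    (hk : SingleCondition K k) {u : Fin 3 → K} (hu : u ≠ 0) (v : Fin 3 → K) :
    ddt (liKaleyskiMap k) u (liKaleyskiMap k (v + u) - liKaleyskiMap k v) = 2 ^ Nat.gcd k m := by
  rw [← card_fixed_pow hK k]
  symm
  refine Nat.card_eq_of_bijective (fun t => ⟨v + t.1 • u, ?_⟩) ⟨?_, ?_⟩
  · exact (liKaleyskiMap_derivative_eq_iff hk hu).2 ⟨t.1, t.2, add_sub_cancel_left _ _⟩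
  · intro s t hst
    have := add_left_cancel (congrArg Subtype.val hst)
    exact Subtype.ext (smul_left_injective K hu this)
  · rintro ⟨w, hw⟩
    obtain ⟨t, ht, hwt⟩ := (liKaleyskiMap_derivative_eq_iff hk hu).1 hw
    exact ⟨⟨t, ht⟩, Subtype.ext (by simp [← hwt])⟩

theorem hasDifferentialUniformity_liKaleyskiMap [Finite K] {m k : ℕ} (hK : Nat.card K = 2 ^ m)
    (hk : SingleCondition K k) :
    HasDifferentialUniformity (liKaleyskiMap k : (Fin 3 → K) → Fin 3 → K)
      (2 ^ Nat.gcd k m) := by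
  refine ⟨⟨1, _, one_ne_zero, ddt_liKaleyskiMap hK hk one_ne_zero 0⟩, ?_⟩
  rintro _ ⟨u, v, hu, rfl⟩
  rcases isEmpty_or_nonempty {x : Fin 3 → K // liKaleyskiMap k (x + u) - liKaleyskiMap k x = v}
    with h | ⟨⟨x, rfl⟩⟩
  · rw [ddt, Nat.card_of_isEmpty]
    exact Nat.zero_le _
  · exact (ddt_liKaleyskiMap hK hk hu x).le

end LiKaleyski

/-- The two polynomials are reciprocal to each other, so inversion exchanges their roots. -/
theorem singleCondition_of_ne_zero {K : Type*} [Field K] {k : ℕ}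
    (h : ∀ X : K, X ^ ((2 ^ k) ^ 2 + 2 ^ k + 1) + X + 1 ≠ 0) : SingleCondition K k := by
  intro X hX
  have hX0 : X ≠ 0 := by
    rintro rfl
    simp at hX
  apply h X⁻¹
  rw [pow_succ] at hX ⊢
  generalize (2 ^ k) ^ 2 + 2 ^ k = a at hX
  calc X⁻¹ ^ a * X⁻¹ + X⁻¹ + 1 = X⁻¹ ^ a * X⁻¹ * (X ^ a * X + X ^ a + 1) := by
        rw [inv_pow]
        field_simp
        ring
    _ = 0 := by rw [hX, mul_zero]

/-- Coordinate permutations suffice: exchange `x` and `y` in the input and rotate the output. -/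
theorem linearlyEquivalent_liKaleyskiMap_mainMap {K : Type*} [Field K] [Algebra (ZMod 2) K]
    (k : ℕ) :
    LinearlyEquivalent (ZMod 2) (liKaleyskiMap k : (Fin 3 → K) → Fin 3 → K)
      (mainMap k 1 0 1) := by
  refine ⟨LinearEquiv.funCongrLeft (ZMod 2) K (finRotate 3).symm,
    LinearEquiv.funCongrLeft (ZMod 2) K (Equiv.swap 0 1), ?_⟩
  ext v i
  have h2 : (Equiv.swap (0 : Fin 3) 1) 2 = 2 := by decide
  have r0 : (finRotate 3).symm 0 = 2 := by decide
  have r1 : (finRotate 3).symm 1 = 0 := by decide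
  have r2 : (finRotate 3).symm 2 = 1 := by decide
  fin_cases i <;>
    simp [liKaleyskiMap, mainMap, LinearEquiv.funCongrLeft_apply, LinearMap.funLeft_apply, h2,
      r0, r1, r2] <;>
    ring

theorem proposition3p4 {K : Type*} [Field K] [Finite K] [Algebra (ZMod 2) K] (m k : ℕ)
    (hK : Nat.card K = 2 ^ m) :
    LinearlyEquivalent (ZMod 2) (liKaleyskiMap k : (Fin 3 → K) → Fin 3 → K) (mainMap k 1 0 1) ∧
    (LiKaleyskiConditions K k → SingleCondition K k) ∧
    (SingleCondition K k →
      HasDifferentialUniformity (liKaleyskiMap k : (Fin 3 → K) → Fin 3 → K)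
        (2 ^ Nat.gcd k m)) := by
  have : CharP K 2 := charP_of_injective_algebraMap (algebraMap (ZMod 2) K).injective 2
  exact ⟨linearlyEquivalent_liKaleyskiMap_mainMap k, fun h => singleCondition_of_ne_zero h.1,
    hasDifferentialUniformity_liKaleyskiMap hK⟩
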